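/- Let $D^*=\{p\in\mathbb{R}^2: 0<|p-c|<R\}$ be a punctured disk, where $c\in\mathbb{R}^2$ and $R>0$, and let $u:D^*\to\mathbb{R}$ be of class $C^2$. Suppose that the graph $z=u(x,y)$ over $D^*$ satisfies an elliptic Weingarten equation, i.e. there are $\alpha\in\mathbb{R}$ and a $C^1$ function $g:[\alpha,\infty)\to\mathbb{R}$ with $g'<0$ on $[\alpha,\infty)$ and $g(\alpha)=\alpha$ such that, for one of the two orientations of the graph (unit normal everywhere pointing upwards, or everywhere pointing downwards), its principal curvatures $\kappa_1\geq\kappa_2$ satisfy $$\kappa_1\geq\alpha,\qquad \kappa_2=g(\kappa_1)$$ at every point of $D^*$. Then $u$ is bounded near the puncture: there are $\delta\in(0,R]$ and $C\in\mathbb{R}$ such that $|u(p)|\leq C$ for all $p$ with $0<|p-c|<\delta$. -/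

import Mathlib

namespace EllipticWeingarten

/-- The Euclidean plane. -/
abbrev Plane : Type := EuclideanSpace ℝ (Fin 2)

/-- The open disk of radius `R` about `c`, punctured at its centre. -/
def puncturedDisk (c : Plane) (R : ℝ) : Set Plane := Metric.ball c R \ {c}

/-- The partial derivative `∂ u / ∂ x_i`. -/
noncomputable def partialDeriv (i : Fin 2) (u : Plane → ℝ) (p : Plane) : ℝ :=
  fderiv ℝ u p (EuclideanSpace.single i 1)

/-- The area element `√(1 + |∇ u|²)` of the graph `z = u(x, y)`. -/
noncomputable def areaElement (u : Plane → ℝ) (p : Plane) : ℝ :=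
  Real.sqrt (1 + ∑ i, partialDeriv i u p ^ 2)

/-- The first fundamental form of the graph `z = u(x, y)` in the coordinates `(x, y)`:
`I_ij = δ_ij + u_i u_j`. -/
noncomputable def firstForm (u : Plane → ℝ) (p : Plane) : Matrix (Fin 2) (Fin 2) ℝ :=
  Matrix.of fun i j => (if i = j then 1 else 0) + partialDeriv i u p * partialDeriv j u p

/-- The second fundamental form of the graph `z = u(x, y)` in the coordinates `(x, y)`, with
respect to the unit normal `ε (-∇ u, 1) / √(1 + |∇ u|²)`, which points upwards for `ε = 1` and
downwards for `ε = -1`: `II_ij = ε u_ij / √(1 + |∇ u|²)`. -/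
noncomputable def secondForm (ε : ℝ) (u : Plane → ℝ) (p : Plane) :
    Matrix (Fin 2) (Fin 2) ℝ :=
  Matrix.of fun i j => ε * partialDeriv i (partialDeriv j u) p / areaElement u p

/-- The matrix `I⁻¹ II` of the shape operator. The matrix `I` is always invertible, since
`det I = 1 + |∇ u|²`. -/
noncomputable def shapeOperator (ε : ℝ) (u : Plane → ℝ) (p : Plane) :
    Matrix (Fin 2) (Fin 2) ℝ :=
  (firstForm u p)⁻¹ * secondForm ε u p

/-- `κ₁ ≥ κ₂` are the principal curvatures at `(p, u p)` of the graph of `u`, oriented by `ε`: the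
eigenvalues of the shape operator, counted with multiplicity. -/
def ArePrincipalCurvatures (ε : ℝ) (u : Plane → ℝ) (p : Plane) (κ₁ κ₂ : ℝ) : Prop :=
  κ₂ ≤ κ₁ ∧
    (shapeOperator ε u p).charpoly =
      (Polynomial.X - Polynomial.C κ₁) * (Polynomial.X - Polynomial.C κ₂)

/-- `g` defines an elliptic Weingarten equation `κ₂ = g(κ₁)` with umbilical constant `α`: it is a
`C¹` function on `[α, ∞)` with `g' < 0` there (one-sided at `α`) and `g(α) = α`. -/
structure IsEllipticFunction (α : ℝ) (g : ℝ → ℝ) : Prop where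
  contDiffOn : ContDiffOn ℝ 1 g (Set.Ici α)
  deriv_neg : ∀ x ∈ Set.Ici α, derivWithin g (Set.Ici α) x < 0
  umbilical : g α = α

/-- The graph of `u` over the open set `Ω` is a `C²` surface which, for one of its two
orientations, satisfies the elliptic Weingarten equation `κ₂ = g(κ₁)` at every point, for some
admissible `g` on some `[α, ∞)`. -/
def IsEllipticWeingartenGraph (Ω : Set Plane) (u : Plane → ℝ) : Prop :=
  ContDiffOn ℝ 2 u Ω ∧
    ∃ (α : ℝ) (g : ℝ → ℝ), IsEllipticFunction α g ∧
      ∃ ε : ℝ, (ε = 1 ∨ ε = -1) ∧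
        ∀ p ∈ Ω, ∃ κ₁ κ₂ : ℝ,
          ArePrincipalCurvatures ε u p κ₁ κ₂ ∧ κ₁ ∈ Set.Ici α ∧ κ₂ = g κ₁

end EllipticWeingarten

namespace EllipticWeingarten

open Filter Topology

/-! The graph is compared with tori of fixed size whose hole shrinks to the puncture. After
replacing `u` by `-u` if necessary, the normal points upwards. Take a circular arc of curvature `A`
that starts vertically at distance `ε` from the axis, and rotate it. In the upward orientation the
resulting surface has meridian curvature `A`, and near the axis its other curvature is at most `-B`,
for any prescribed `B`. Where it touches the graph from above, the graph has `κ₁ ≤ A` and `κ₂ ≤ -B`.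
Since `g` is decreasing, `κ₁ ≤ A` forces `κ₂ ≥ g A`, which is absurd once `B > |g A|`. The vertical
start excludes contact at the inner circle, so `u - torusProfile` is maximal on a fixed outer
circle. The arc has height at most `1 / A`, so the bound does not depend on `ε` (`torus_contact`,
`exists_gt_of_inner_boundary`, `bddAbove_of_no_torus_contact`).

For the lower bound the same comparison applies to `-u`, whose curvatures are `-κ₂ ≥ -κ₁`, provided
`g` takes a negative value. Otherwise both curvatures are nonnegative, and convexity along rays
bounds `u` from below (`bddBelow_of_hessianForm_nonneg`). -/

/-- The Hessian of `u` at `p`, as a quadratic form. -/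
noncomputable def hessianForm (u : Plane → ℝ) (p v : Plane) : ℝ :=
  ∑ i, ∑ j, v i * v j * partialDeriv i (partialDeriv j u) p

/-- The first fundamental form of the graph of `u`, as a quadratic form. -/
noncomputable def metricForm (u : Plane → ℝ) (p v : Plane) : ℝ :=
  ‖v‖ ^ 2 + fderiv ℝ u p v ^ 2

/-! ### Calculus of the two quadratic forms -/

theorem fderiv_eq_sum (u : Plane → ℝ) (p v : Plane) :
    fderiv ℝ u p v = ∑ i, v i * partialDeriv i u p := by
  have hv : v = ∑ i, v i • (EuclideanSpace.single i (1 : ℝ) : Plane) := by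
    ext k
    fin_cases k <;> simp [Fin.sum_univ_two]
  conv_lhs => rw [hv]
  simp [partialDeriv]

theorem plane_norm_sq (v : Plane) : ‖v‖ ^ 2 = v 0 ^ 2 + v 1 ^ 2 := by
  simp [EuclideanSpace.norm_sq_eq, Fin.sum_univ_two]

theorem metricForm_pos (u : Plane → ℝ) (p : Plane) {v : Plane} (hv : v ≠ 0) :
    0 < metricForm u p v := by
  have := norm_pos_iff.2 hv
  unfold metricForm
  positivity

theorem areaElement_pos (u : Plane → ℝ) (p : Plane) : 0 < areaElement u p := by
  unfold areaElement
  positivity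

theorem isOpen_puncturedDisk (c : Plane) (R : ℝ) : IsOpen (puncturedDisk c R) :=
  Metric.isOpen_ball.sdiff isClosed_singleton

theorem partialDeriv_neg (i : Fin 2) (u : Plane → ℝ) :
    partialDeriv i (fun q => -u q) = fun q => -partialDeriv i u q := by
  funext q
  simp [partialDeriv, fderiv_fun_neg]

theorem hessianForm_neg (u : Plane → ℝ) (p v : Plane) :
    hessianForm (fun q => -u q) p v = -hessianForm u p v := by
  simp only [hessianForm, partialDeriv_neg, mul_neg, Finset.sum_neg_distrib]

theorem metricForm_neg (u : Plane → ℝ) (p v : Plane) :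
    metricForm (fun q => -u q) p v = metricForm u p v := by
  simp [metricForm, fderiv_fun_neg]

theorem areaElement_neg (u : Plane → ℝ) (p : Plane) :
    areaElement (fun q => -u q) p = areaElement u p := by
  simp [areaElement, partialDeriv_neg]

theorem differentiableAt_partialDeriv {u : Plane → ℝ} {p : Plane} (hu : ContDiffAt ℝ 2 u p)
    (i : Fin 2) : DifferentiableAt ℝ (partialDeriv i u) p := by
  have h : DifferentiableAt ℝ (fderiv ℝ u) p :=
    (hu.fderiv_right (m := 1) (by norm_num)).differentiableAt (by norm_num)
  exact h.clm_apply (differentiableAt_const _)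

theorem partialDeriv_comm {u : Plane → ℝ} {p : Plane} (hu : ContDiffAt ℝ 2 u p) (i j : Fin 2) :
    partialDeriv i (partialDeriv j u) p = partialDeriv j (partialDeriv i u) p := by
  have h : DifferentiableAt ℝ (fderiv ℝ u) p :=
    (hu.fderiv_right (m := 1) (by norm_num)).differentiableAt (by norm_num)
  have key : ∀ i j : Fin 2, partialDeriv i (partialDeriv j u) p =
      fderiv ℝ (fderiv ℝ u) p (EuclideanSpace.single i 1) (EuclideanSpace.single j 1) := by
    intro i j
    change fderiv ℝ (fun q => fderiv ℝ u q (EuclideanSpace.single j 1)) p _ = _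
    rw [fderiv_clm_apply h (differentiableAt_const _)]
    simp
  rw [key, key]
  exact (hu.isSymmSndFDerivAt (by simp)).eq _ _

theorem hasDerivAt_line {u : Plane → ℝ} {p v : Plane} {t : ℝ}
    (hu : ContDiffAt ℝ 2 u (p + t • v)) :
    HasDerivAt (fun x : ℝ => u (p + x • v)) (fderiv ℝ u (p + t • v) v) t := by
  have h : HasDerivAt (fun x : ℝ => p + x • v) v t := by
    simpa using ((hasDerivAt_id t).smul_const v).const_add p
  exact (hu.differentiableAt (by norm_num)).hasFDerivAt.comp_hasDerivAt t h

theorem hasDerivAt_fderiv_line {u : Plane → ℝ} {p v : Plane} {t : ℝ}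
    (hu : ContDiffAt ℝ 2 u (p + t • v)) :
    HasDerivAt (fun x : ℝ => fderiv ℝ u (p + x • v) v) (hessianForm u (p + t • v) v) t := by
  have h : HasDerivAt (fun x : ℝ => p + x • v) v t := by
    simpa using ((hasDerivAt_id t).smul_const v).const_add p
  have h1 : ∀ i, HasDerivAt (fun x : ℝ => partialDeriv i u (p + x • v))
      (fderiv ℝ (partialDeriv i u) (p + t • v) v) t := fun i =>
    HasFDerivAt.comp_hasDerivAt (f := fun x : ℝ => p + x • v) t
      (differentiableAt_partialDeriv hu i).hasFDerivAt h
  have h2 := ((h1 0).const_mul (v 0)).fun_add ((h1 1).const_mul (v 1))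
  have e1 : (fun x : ℝ => fderiv ℝ u (p + x • v) v) = fun x =>
      v 0 * partialDeriv 0 u (p + x • v) + v 1 * partialDeriv 1 u (p + x • v) := by
    funext x
    simp [fderiv_eq_sum, Fin.sum_univ_two]
  rw [e1]
  refine h2.congr_deriv ?_
  simp only [hessianForm, fderiv_eq_sum, Fin.sum_univ_two]
  ring

/-! ### Principal curvatures as extrema -/

/-- If `κ₁ ≥ κ₂` are the roots of `det (L - κ M)` for symmetric forms `L` and `M`, with `M`
positive definite, then `L ≥ κ₂ M`. -/
theorem min_root_mul_le {E F G l m n κ₁ κ₂ : ℝ} (hE : 0 < E) (hD : 0 < E * G - F ^ 2)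
    (hκ : κ₂ ≤ κ₁) (htr : G * l - 2 * F * m + E * n = (E * G - F ^ 2) * (κ₁ + κ₂))
    (hdet : l * n - m ^ 2 = (E * G - F ^ 2) * (κ₁ * κ₂)) (a b : ℝ) :
    κ₂ * (E * a ^ 2 + 2 * F * a * b + G * b ^ 2) ≤ l * a ^ 2 + 2 * m * a * b + n * b ^ 2 := by
  set D := E * G - F ^ 2 with hDdef
  -- The form `L - κ₂ M` is degenerate and its trace relative to `M` is nonnegative, so it is
  -- positive semidefinite.
  obtain ⟨l', hl⟩ : ∃ x, x = l - κ₂ * E := ⟨_, rfl⟩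
  obtain ⟨m', hm⟩ : ∃ x, x = m - κ₂ * F := ⟨_, rfl⟩
  obtain ⟨n', hn⟩ : ∃ x, x = n - κ₂ * G := ⟨_, rfl⟩
  have h1 : l' * n' = m' ^ 2 := by
    subst hl hm hn
    linear_combination hdet - κ₂ * htr - κ₂ ^ 2 * hDdef
  have h2 : G * l' - 2 * F * m' + E * n' = D * (κ₁ - κ₂) := by
    subst hl hm hn
    linear_combination htr + 2 * κ₂ * hDdef
  suffices h : 0 ≤ l' * a ^ 2 + 2 * m' * a * b + n' * b ^ 2 by
    subst hl hm hn
    linarith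
  -- If `l'` were negative, the left side would be nonpositive and the right side positive.
  have h3 : l' * (E * D * (κ₁ - κ₂)) = D * l' ^ 2 + (F * l' - E * m') ^ 2 := by
    linear_combination -l' * E * h2 + E ^ 2 * h1 - l' ^ 2 * hDdef
  have hk : 0 ≤ D * (κ₁ - κ₂) := mul_nonneg hD.le (sub_nonneg.2 hκ)
  have hl0 : 0 ≤ l' := by
    by_contra hneg
    have hneg := not_le.1 hneg
    have h4 : l' * (E * D * (κ₁ - κ₂)) ≤ 0 :=
      mul_nonpos_of_nonpos_of_nonneg hneg.le (by rw [mul_assoc]; exact mul_nonneg hE.le hk)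
    have h5 : 0 < D * l' ^ 2 := mul_pos hD (by nlinarith)
    nlinarith [sq_nonneg (F * l' - E * m')]
  rcases hl0.eq_or_lt with h0 | hpos
  · subst h0
    have hm0 : m' = 0 := by nlinarith
    subst hm0
    have : 0 ≤ n' := by
      by_contra hneg
      nlinarith [not_le.1 hneg]
    nlinarith [mul_nonneg this (sq_nonneg b)]
  · have h6 : 0 ≤ l' * (l' * a ^ 2 + 2 * m' * a * b + n' * b ^ 2) := by
      have : l' * (l' * a ^ 2 + 2 * m' * a * b + n' * b ^ 2) = (l' * a + m' * b) ^ 2 := by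
        linear_combination b ^ 2 * h1
      rw [this]
      positivity
    exact nonneg_of_mul_nonneg_right h6 hpos

/-- The form `L - κ M` has zero determinant, and the vector is taken from its kernel. -/
theorem exists_root_vector {E F G l m n κ : ℝ}
    (h : (l - κ * E) * (n - κ * G) = (m - κ * F) ^ 2) :
    ∃ a b : ℝ, (a ≠ 0 ∨ b ≠ 0) ∧
      l * a ^ 2 + 2 * m * a * b + n * b ^ 2 =
        κ * (E * a ^ 2 + 2 * F * a * b + G * b ^ 2) := by
  by_cases h0 : l - κ * E = 0
  · exact ⟨1, 0, by simp, by linear_combination h0⟩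
  · exact ⟨-(m - κ * F), l - κ * E, Or.inr h0, by linear_combination (l - κ * E) * h⟩

theorem shapeOperator_trace_det {ε : ℝ} {u : Plane → ℝ} {p : Plane} {κ₁ κ₂ : ℝ}
    (h : ArePrincipalCurvatures ε u p κ₁ κ₂) :
    (shapeOperator ε u p).trace = κ₁ + κ₂ ∧ (shapeOperator ε u p).det = κ₁ * κ₂ := by
  have h2 := h.2
  rw [Matrix.charpoly_fin_two] at h2
  have e0 := congrArg (Polynomial.eval 0) h2
  have e1 := congrArg (Polynomial.eval 1) h2
  simp at e0 e1
  constructor <;> linarith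

/-- Multiplying the shape operator by `I`, or its trace by `det I`, clears the inverse and gives the
polynomial relations that `min_root_mul_le` requires. -/
theorem fundamentalForm_relations {ε : ℝ} {u : Plane → ℝ} {p : Plane} {κ₁ κ₂ : ℝ}
    (h : ArePrincipalCurvatures ε u p κ₁ κ₂) :
    let I := firstForm u p
    let S := secondForm ε u p
    0 < I 0 0 ∧ I 1 0 = I 0 1 ∧ 0 < I 0 0 * I 1 1 - I 0 1 ^ 2 ∧
      I 1 1 * S 0 0 - I 0 1 * (S 1 0 + S 0 1) + I 0 0 * S 1 1 =
        (I 0 0 * I 1 1 - I 0 1 ^ 2) * (κ₁ + κ₂) ∧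
      S 0 0 * S 1 1 - S 0 1 * S 1 0 = (I 0 0 * I 1 1 - I 0 1 ^ 2) * (κ₁ * κ₂) := by
  intro I S
  have hE : 0 < I 0 0 := by
    simp only [I, firstForm, Matrix.of_apply, if_true]
    nlinarith [sq_nonneg (partialDeriv 0 u p)]
  have hsymm : I 1 0 = I 0 1 := by
    simp [I, firstForm, mul_comm]
  have hD : 0 < I 0 0 * I 1 1 - I 0 1 ^ 2 := by
    simp only [I, firstForm, Matrix.of_apply, if_true, zero_ne_one, if_false]
    nlinarith [sq_nonneg (partialDeriv 0 u p), sq_nonneg (partialDeriv 1 u p)]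
  have hdetI : I.det = I 0 0 * I 1 1 - I 0 1 ^ 2 := by
    rw [Matrix.det_fin_two, hsymm]
    ring
  have hunit : IsUnit I.det := by
    rw [hdetI]
    exact hD.ne'.isUnit
  obtain ⟨htr, hdet⟩ := shapeOperator_trace_det h
  refine ⟨hE, hsymm, hD, ?_, ?_⟩
  · rw [← htr, ← hdetI]
    have : (I.adjugate * S).trace = I.det * (shapeOperator ε u p).trace := by
      rw [← smul_eq_mul I.det, ← Matrix.trace_smul, shapeOperator, ← Matrix.smul_mul, Matrix.inv_def,
        smul_smul, Ring.mul_inverse_cancel _ hunit, one_smul]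
    rw [← this, Matrix.trace_fin_two]
    simp [Matrix.adjugate_fin_two, Matrix.mul_apply, Fin.sum_univ_two, hsymm]
    ring
  · rw [← hdet, ← hdetI, ← Matrix.det_mul, shapeOperator,
      Matrix.mul_nonsing_inv_cancel_left _ _ hunit, Matrix.det_fin_two]

/-- The principal curvatures are the extrema of the quotient of the fundamental forms. -/
theorem ArePrincipalCurvatures.extrema {ε : ℝ} {u : Plane → ℝ} {p : Plane} {κ₁ κ₂ : ℝ}
    (hu : ContDiffAt ℝ 2 u p) (h : ArePrincipalCurvatures ε u p κ₁ κ₂) :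
    (∀ v, κ₂ * (areaElement u p * metricForm u p v) ≤ ε * hessianForm u p v) ∧
    (∀ v, ε * hessianForm u p v ≤ κ₁ * (areaElement u p * metricForm u p v)) ∧
    (∃ v, v ≠ 0 ∧ ε * hessianForm u p v = κ₂ * (areaElement u p * metricForm u p v)) ∧
    (∃ v, v ≠ 0 ∧ ε * hessianForm u p v = κ₁ * (areaElement u p * metricForm u p v)) := by
  have hW := areaElement_pos u p
  obtain ⟨hE, hsymm, hD, htr, hdet⟩ := fundamentalForm_relations h
  have hS : secondForm ε u p 1 0 = secondForm ε u p 0 1 := by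
    simp [secondForm, partialDeriv_comm hu 1 0]
  rw [hS] at htr hdet
  set I := firstForm u p
  set S := secondForm ε u p
  have hform : ∀ v : Plane, ε * hessianForm u p v = areaElement u p *
      (S 0 0 * v 0 ^ 2 + 2 * S 0 1 * v 0 * v 1 + S 1 1 * v 1 ^ 2) := by
    intro v
    simp only [S, secondForm, hessianForm, Matrix.of_apply, Fin.sum_univ_two,
      partialDeriv_comm hu 1 0]
    field_simp
    ring
  have hmet : ∀ v : Plane, metricForm u p v =
      I 0 0 * v 0 ^ 2 + 2 * I 0 1 * v 0 * v 1 + I 1 1 * v 1 ^ 2 := by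
    intro v
    simp only [I, firstForm, metricForm, Matrix.of_apply, fderiv_eq_sum, plane_norm_sq,
      Fin.sum_univ_two, if_true, zero_ne_one, if_false]
    ring
  have hvec : ∀ κ : ℝ, (S 0 0 - κ * I 0 0) * (S 1 1 - κ * I 1 1) = (S 0 1 - κ * I 0 1) ^ 2 →
      ∃ v : Plane, v ≠ 0 ∧
        ε * hessianForm u p v = κ * (areaElement u p * metricForm u p v) := by
    intro κ hκ
    obtain ⟨a, b, hab, e⟩ := exists_root_vector hκ
    refine ⟨!₂[a, b], ?_, ?_⟩
    · intro h0
      have h1 := congrArg (fun v : Plane => v 0) h0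
      have h2 := congrArg (fun v : Plane => v 1) h0
      simp at h1 h2
      rcases hab with h | h
      · exact h h1
      · exact h h2
    · rw [hform, hmet]
      simp only [Matrix.cons_val_zero, Matrix.cons_val_one, Matrix.cons_val_fin_one]
      rw [e]
      ring
  refine ⟨fun v => ?_, fun v => ?_, hvec κ₂ (by linear_combination hdet - κ₂ * htr),
    hvec κ₁ (by linear_combination hdet - κ₁ * htr)⟩
  · rw [hform, hmet]
    have := min_root_mul_le (l := S 0 0) (m := S 0 1) (n := S 1 1) hE hD h.1
      (by linarith) (by linarith) (v 0) (v 1)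
    nlinarith [mul_le_mul_of_nonneg_left this hW.le]
  -- The upper bound is the lower bound for `-S`, whose roots are `-κ₂ ≥ -κ₁`.
  · rw [hform, hmet]
    have := min_root_mul_le (l := -S 0 0) (m := -S 0 1) (n := -S 1 1) (κ₁ := -κ₂) (κ₂ := -κ₁)
      hE hD (neg_le_neg h.1) (by linarith) (by linarith) (v 0) (v 1)
    nlinarith [mul_le_mul_of_nonneg_left this hW.le]

/-! ### Contact with radial functions -/

/-- Second derivative test, as a necessary condition at a local maximum. -/
theorem IsLocalMax.second_deriv_nonpos {φ φ' : ℝ → ℝ} {a d : ℝ} (hmax : IsLocalMax φ a)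
    (h1 : ∀ᶠ t in 𝓝 a, HasDerivAt φ (φ' t) t) (h2 : HasDerivAt φ' d a) :
    φ' a = 0 ∧ d ≤ 0 := by
  have h0 : φ' a = 0 := hmax.hasDerivAt_eq_zero h1.self_of_nhds
  refine ⟨h0, ?_⟩
  by_contra! hd
  have e : deriv φ =ᶠ[𝓝 a] φ' := h1.mono fun t ht => ht.deriv
  have e2 : deriv (deriv φ) a = d := by rw [e.deriv_eq, h2.deriv]
  -- With `d > 0` the point would also be a local minimum, so `φ` would be locally constant and `d =
  -- 0`.
  have hmin : IsLocalMin φ a := isLocalMin_of_deriv_deriv_pos (by rwa [e2])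
    (by rw [e.self_of_nhds, h0]) h1.self_of_nhds.continuousAt
  have hc : φ =ᶠ[𝓝 a] fun _ => φ a := by
    filter_upwards [hmax, hmin] with t ht ht'
    exact le_antisymm ht ht'
  have : deriv (deriv φ) a = 0 := by
    rw [hc.deriv.deriv_eq]
    simp
  linarith

theorem hasDerivAt_norm_line {q v : Plane} {t : ℝ} (h : q + t • v ≠ 0) :
    HasDerivAt (fun x : ℝ => ‖q + x • v‖) (inner ℝ (q + t • v) v / ‖q + t • v‖) t := by
  have h1 : HasDerivAt (fun x : ℝ => q + x • v) v t := by
    simpa using ((hasDerivAt_id t).smul_const v).const_add q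
  have h2 := h1.norm_sq.sqrt (by positivity)
  have e : (fun x : ℝ => ‖q + x • v‖) = fun x => √(‖q + x • v‖ ^ 2) := by
    funext x
    rw [Real.sqrt_sq (norm_nonneg _)]
  rw [e]
  refine h2.congr_deriv ?_
  rw [Real.sqrt_sq (norm_nonneg _)]
  field_simp

theorem hasDerivAt_inner_div_norm_line {q v : Plane} (h : q ≠ 0) :
    HasDerivAt (fun x : ℝ => inner ℝ (q + x • v) v / ‖q + x • v‖)
      ((‖v‖ ^ 2 - (inner ℝ q v / ‖q‖) ^ 2) / ‖q‖) 0 := by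
  have h1 : HasDerivAt (fun x : ℝ => q + x • v) v 0 := by
    simpa using ((hasDerivAt_id (0 : ℝ)).smul_const v).const_add q
  have h2 : HasDerivAt (fun x : ℝ => inner ℝ (q + x • v) v) (‖v‖ ^ 2) 0 := by
    simpa using h1.inner ℝ (hasDerivAt_const (0 : ℝ) v)
  have h3 := h2.fun_div (hasDerivAt_norm_line (q := q) (v := v) (t := 0) (by simpa using h))
    (by simpa using h)
  refine h3.congr_deriv ?_
  have := norm_pos_iff.2 h
  simp only [zero_smul, add_zero]
  field_simp

/-- Derivatives of a function `u` touched from above by a radial function. -/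
theorem radial_contact {u : Plane → ℝ} {c p : Plane} {f f' : ℝ → ℝ} {f2 : ℝ}
    (hu : ContDiffAt ℝ 2 u p) (hp : p ≠ c)
    (hf : ∀ᶠ ρ in 𝓝 ‖p - c‖, HasDerivAt f (f' ρ) ρ) (hf' : HasDerivAt f' f2 ‖p - c‖)
    (hmax : IsLocalMax (fun x => u x - f ‖x - c‖) p) (v : Plane) :
    fderiv ℝ u p v = f' ‖p - c‖ * (inner ℝ (p - c) v / ‖p - c‖) ∧
      hessianForm u p v ≤ f2 * (inner ℝ (p - c) v / ‖p - c‖) ^ 2 +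
        f' ‖p - c‖ * ((‖v‖ ^ 2 - (inner ℝ (p - c) v / ‖p - c‖) ^ 2) / ‖p - c‖) := by
  have hq : p - c ≠ 0 := sub_ne_zero.2 hp
  set q := p - c with hqdef
  have hcont : Tendsto (fun t : ℝ => p + t • v) (𝓝 0) (𝓝 p) := by
    have : Continuous fun t : ℝ => p + t • v := by fun_prop
    simpa using this.tendsto 0
  have hcontq : Tendsto (fun t : ℝ => q + t • v) (𝓝 0) (𝓝 q) := by
    have : Continuous fun t : ℝ => q + t • v := by fun_prop
    simpa using this.tendsto 0
  have e : ∀ t : ℝ, p + t • v - c = q + t • v := fun t => by rw [hqdef]; abel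
  have hu' : ∀ᶠ x in 𝓝 p, ContDiffAt ℝ 2 u x := hu.eventually (by simp)
  have hmax' : IsLocalMax (fun t : ℝ => u (p + t • v) - f ‖q + t • v‖) 0 := by
    have := hcont.eventually hmax
    filter_upwards [this] with t ht
    simpa [e, ← hqdef] using ht
  have h1 : ∀ᶠ t in 𝓝 (0 : ℝ), HasDerivAt (fun t : ℝ => u (p + t • v) - f ‖q + t • v‖)
      (fderiv ℝ u (p + t • v) v - f' ‖q + t • v‖ * (inner ℝ (q + t • v) v / ‖q + t • v‖)) t := by
    filter_upwards [hcont.eventually hu', hcontq.norm.eventually hf,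
      hcontq.eventually (isOpen_ne.mem_nhds hq)] with t a b d
    exact (hasDerivAt_line a).fun_sub (b.comp t (hasDerivAt_norm_line d))
  have hn := hasDerivAt_norm_line (q := q) (v := v) (t := 0) (by simpa using hq)
  have hf0 : HasDerivAt f' f2 ‖q + (0 : ℝ) • v‖ := by simpa using hf'
  have h2 := (hasDerivAt_fderiv_line (u := u) (p := p) (v := v) (t := 0) (by simpa using hu)).fun_sub
    ((hf0.comp 0 hn).fun_mul (hasDerivAt_inner_div_norm_line (v := v) hq))
  obtain ⟨r1, r2⟩ := IsLocalMax.second_deriv_nonpos hmax' h1 h2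
  simp only [zero_smul, add_zero, Function.comp] at r1 r2
  constructor
  · linarith
  · nlinarith

/-! ### The torus barrier -/

/-- The inner lower part of the meridian of a torus, a circular arc of curvature `A` which starts
vertically at `ρ = ε`. -/
noncomputable def torusProfile (A ε ρ : ℝ) : ℝ :=
  -(√(1 - (1 - A * (ρ - ε)) ^ 2) / A)

theorem continuous_torusProfile (A ε : ℝ) : Continuous (torusProfile A ε) := by
  unfold torusProfile
  fun_prop

theorem torusProfile_nonpos {A : ℝ} (hA : 0 < A) (ε ρ : ℝ) : torusProfile A ε ρ ≤ 0 := by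
  unfold torusProfile
  have := Real.sqrt_nonneg (1 - (1 - A * (ρ - ε)) ^ 2)
  exact neg_nonpos.2 (by positivity)

theorem neg_inv_le_torusProfile {A : ℝ} (hA : 0 < A) (ε ρ : ℝ) : -(1 / A) ≤ torusProfile A ε ρ := by
  unfold torusProfile
  have : √(1 - (1 - A * (ρ - ε)) ^ 2) ≤ 1 :=
    Real.sqrt_le_one.2 (by linarith [sq_nonneg (1 - A * (ρ - ε))])
  gcongr

theorem hasDerivAt_torusProfile {A ε ρ : ℝ} (hA : 0 < A)
    (h : 0 < 1 - (1 - A * (ρ - ε)) ^ 2) :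
    HasDerivAt (torusProfile A ε)
      (-(1 - A * (ρ - ε)) / √(1 - (1 - A * (ρ - ε)) ^ 2)) ρ := by
  have h0 : HasDerivAt (fun x : ℝ => 1 - A * (x - ε)) (-A) ρ := by
    simpa using (((hasDerivAt_id ρ).sub_const ε).const_mul A).const_sub 1
  have h1 := ((((h0.fun_pow 2).const_sub 1).sqrt h.ne').div_const A).fun_neg
  refine h1.congr_deriv ?_
  have := Real.sqrt_pos.2 h
  field_simp
  simp [mul_comm]

theorem hasDerivAt_deriv_torusProfile {A ε ρ : ℝ} (h : 0 < 1 - (1 - A * (ρ - ε)) ^ 2) :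
    HasDerivAt (fun x => -(1 - A * (x - ε)) / √(1 - (1 - A * (x - ε)) ^ 2))
      (A / √(1 - (1 - A * (ρ - ε)) ^ 2) ^ 3) ρ := by
  have h0 : HasDerivAt (fun x : ℝ => 1 - A * (x - ε)) (-A) ρ := by
    simpa using (((hasDerivAt_id ρ).sub_const ε).const_mul A).const_sub 1
  have hs := Real.sqrt_pos.2 h
  have h1 := h0.fun_neg.fun_div (((h0.fun_pow 2).const_sub 1).sqrt h.ne') hs.ne'
  refine h1.congr_deriv ?_
  have h2 : √(1 - (1 - A * (ρ - ε)) ^ 2) ^ 2 = 1 - (1 - A * (ρ - ε)) ^ 2 := Real.sq_sqrt h.le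
  set k := √(1 - (1 - A * (ρ - ε)) ^ 2)
  set y := 1 - A * (ρ - ε)
  field_simp
  simp only [Nat.cast_ofNat, Nat.add_one_sub_one, pow_one]
  linear_combination 2 * A * h2

/-- Where a torus touches the graph of `u` from above, the principal curvatures of the graph are at
most those of the torus. -/
theorem torus_contact {u : Plane → ℝ} {c p : Plane} {A B ε : ℝ} (hu : ContDiffAt ℝ 2 u p)
    (hA : 0 < A) (hε : 0 < ε) (hp : ε < ‖p - c‖) (hAp : A * ‖p - c‖ ≤ 1 / 2)
    (hBp : B * ‖p - c‖ ≤ 1 / 2)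
    (hmax : IsLocalMax (fun x => u x - torusProfile A ε ‖x - c‖) p) :
    (∀ v, hessianForm u p v ≤ A * (areaElement u p * metricForm u p v)) ∧
      ∃ v, v ≠ 0 ∧ hessianForm u p v ≤ -B * (areaElement u p * metricForm u p v) := by
  have hρ : 0 < ‖p - c‖ := hε.trans hp
  have hpc : p ≠ c := sub_ne_zero.1 (norm_pos_iff.1 hρ)
  have hpos : 0 < 1 - (1 - A * (‖p - c‖ - ε)) ^ 2 := by
    nlinarith [mul_pos hA (sub_pos.2 hp), mul_pos hA hε]
  have hcont : Continuous fun ρ : ℝ => 1 - (1 - A * (ρ - ε)) ^ 2 := by fun_prop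
  have hev : ∀ᶠ ρ in 𝓝 ‖p - c‖, 0 < 1 - (1 - A * (ρ - ε)) ^ 2 :=
    hcont.continuousAt.eventually (lt_mem_nhds hpos)
  have key := radial_contact hu hpc
    (hev.mono fun ρ h => hasDerivAt_torusProfile hA h) (hasDerivAt_deriv_torusProfile hpos) hmax
  have hs : 1 / 2 ≤ 1 - A * (‖p - c‖ - ε) := by nlinarith [mul_pos hA hε]
  have hk := Real.sqrt_pos.2 hpos
  have hk2 := Real.sq_sqrt hpos.le
  set k := √(1 - (1 - A * (‖p - c‖ - ε)) ^ 2)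
  set s := 1 - A * (‖p - c‖ - ε)
  have hqsq := plane_norm_sq (p - c)
  set q := p - c
  set ρ := ‖q‖
  -- At the contact point the slope is `-s / k` with `k ^ 2 + s ^ 2 = 1`. The torus therefore has
  -- curvature `A` along the meridian and `-s / ρ` along the parallel, and the latter is at most
  -- `-B` because `s ≥ 1 / 2 ≥ B * ρ`.
  have hW : areaElement u p = 1 / k := by
    have hi : ∀ i, partialDeriv i u p = -s / k * (q i / ρ) := by
      intro i
      rw [partialDeriv, (key _).1]
      simp [EuclideanSpace.inner_single_right]
    have : 1 + ∑ i, partialDeriv i u p ^ 2 = (1 / k) ^ 2 := by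
      simp only [hi, Fin.sum_univ_two]
      field_simp
      linear_combination ρ ^ 2 * hk2 - s ^ 2 * hqsq
    rw [areaElement, this, Real.sqrt_sq (by positivity)]
  constructor
  · intro v
    obtain ⟨h1, h2⟩ := key v
    have hx : (inner ℝ q v / ρ) ^ 2 ≤ ‖v‖ ^ 2 := by
      rw [div_pow, div_le_iff₀ (by positivity), ← mul_pow, mul_comm, ← sq_abs]
      exact pow_le_pow_left₀ (abs_nonneg _) (abs_real_inner_le_norm q v) 2
    rw [hW, metricForm, h1]
    set x := inner ℝ q v / ρ
    refine h2.trans ?_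
    have e : A * (1 / k * (‖v‖ ^ 2 + (-s / k * x) ^ 2)) =
        A / k ^ 3 * x ^ 2 + A / k * (‖v‖ ^ 2 - x ^ 2) := by
      field_simp
      linear_combination x ^ 2 * hk2
    rw [e]
    have h3 : 0 ≤ A / k * (‖v‖ ^ 2 - x ^ 2) := mul_nonneg (by positivity) (sub_nonneg.2 hx)
    have h4 : 0 ≤ s / k * ((‖v‖ ^ 2 - x ^ 2) / ρ) :=
      mul_nonneg (div_nonneg (by linarith) hk.le) (div_nonneg (sub_nonneg.2 hx) hρ.le)
    rw [neg_div]
    linarith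
  -- The direction of the parallel is `q` turned by a right angle.
  · refine ⟨!₂[-q 1, q 0], ?_, ?_⟩
    · intro h0
      have h1 := congrArg (fun v : Plane => v 0) h0
      have h2 := congrArg (fun v : Plane => v 1) h0
      simp only [Matrix.cons_val_zero, Matrix.cons_val_one, Matrix.cons_val_fin_one,
        PiLp.zero_apply, neg_eq_zero] at h1 h2
      rw [h1, h2] at hqsq
      nlinarith
    · obtain ⟨h1, h2⟩ := key !₂[-q 1, q 0]
      have hin : inner ℝ q (!₂[-q 1, q 0] : Plane) = 0 := by
        simp [PiLp.inner_apply, Fin.sum_univ_two]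
        ring
      have hv : ‖(!₂[-q 1, q 0] : Plane)‖ ^ 2 = ρ ^ 2 := by
        rw [hqsq, plane_norm_sq]
        simp only [Matrix.cons_val_zero, Matrix.cons_val_one, Matrix.cons_val_fin_one]
        ring
      rw [hin, hv] at h2
      rw [hin] at h1
      rw [hW, metricForm, h1, hv]
      refine h2.trans ?_
      have e1 : A / k ^ 3 * (0 / ρ) ^ 2 + -s / k * ((ρ ^ 2 - (0 / ρ) ^ 2) / ρ) = -(ρ / k * s) := by
        field_simp
        ring
      have e2 : -B * (1 / k * (ρ ^ 2 + (-s / k * (0 / ρ)) ^ 2)) = -(ρ / k * (B * ρ)) := by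
        field_simp
        ring
      rw [e1, e2]
      have : 0 < ρ / k := by positivity
      gcongr
      linarith

/-- The torus profile has infinite slope at its inner end, so a maximum of `u - torusProfile` does
not occur there. -/
theorem exists_gt_of_inner_boundary {u : Plane → ℝ} {c p : Plane} {A ε r : ℝ}
    (hu : DifferentiableAt ℝ u p) (hA : 0 < A) (hε : 0 < ε) (hp : ‖p - c‖ = ε) (hr : ε < r) :
    ∃ x, ε ≤ ‖x - c‖ ∧ ‖x - c‖ ≤ r ∧
      u p - torusProfile A ε ‖p - c‖ < u x - torusProfile A ε ‖x - c‖ := by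
  set q := p - c with hq
  set v := (1 / ε) • q with hv
  have hline : HasDerivAt (fun x : ℝ => p + x • v) v 0 := by
    simpa using ((hasDerivAt_id (0 : ℝ)).smul_const v).const_add p
  have hd : HasDerivAt (fun x : ℝ => u (p + x • v)) (fderiv ℝ u p v) 0 := by
    have hu' : HasFDerivAt u (fderiv ℝ u p) (p + (0 : ℝ) • v) := by simpa using hu.hasFDerivAt
    exact hu'.comp_hasDerivAt 0 hline
  obtain ⟨L, hL0, hL⟩ := hd.isBigO_sub.exists_pos
  have hL := hL.bound
  have hsmall : ∀ᶠ t in 𝓝[>] (0 : ℝ), t < r - ε ∧ A * t < 1 ∧ A * L ^ 2 * t < 1 ∧ 0 < t := by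
    have h1 : ∀ᶠ t in 𝓝 (0 : ℝ), t < r - ε := gt_mem_nhds (sub_pos.2 hr)
    have h2 : ∀ᶠ t in 𝓝 (0 : ℝ), A * t < 1 :=
      (by fun_prop : Continuous fun t : ℝ => A * t).continuousAt.eventually
        (gt_mem_nhds (by simp))
    have h3 : ∀ᶠ t in 𝓝 (0 : ℝ), A * L ^ 2 * t < 1 :=
      (by fun_prop : Continuous fun t : ℝ => A * L ^ 2 * t).continuousAt.eventually
        (gt_mem_nhds (by simp))
    filter_upwards [nhdsWithin_le_nhds h1, nhdsWithin_le_nhds h2, nhdsWithin_le_nhds h3,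
      self_mem_nhdsWithin] with t a b c d using ⟨a, b, c, d⟩
  obtain ⟨t, ⟨ht1, ht2, ht3, ht0⟩, htL⟩ := (hsmall.and (nhdsWithin_le_nhds hL)).exists
  have hnorm : ‖p + t • v - c‖ = ε + t := by
    have : p + t • v - c = ((ε + t) / ε) • q := by
      rw [hv, smul_smul, add_div, div_self hε.ne', add_smul, one_smul, hq, mul_one_div]
      abel
    rw [this, norm_smul, hp, Real.norm_of_nonneg (by positivity)]
    field_simp
  refine ⟨p + t • v, by linarith, by linarith, ?_⟩
  rw [hnorm, hp]
  have hprof : torusProfile A ε ε = 0 := by simp [torusProfile]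
  simp only [zero_smul, add_zero, sub_zero, Real.norm_eq_abs, abs_of_pos ht0] at htL
  have h1 := (abs_le.1 htL).1
  -- Along the ray `u` drops by at most `L * t`, whereas the profile drops like `√(2 * t / A)`,
  -- which is larger for small `t`.
  have h2 : L * t < -torusProfile A ε (ε + t) := by
    rw [torusProfile, neg_neg, lt_div_iff₀ hA]
    refine Real.lt_sqrt_of_sq_lt ?_
    have e : 1 - (1 - A * (ε + t - ε)) ^ 2 - (L * t * A) ^ 2 =
        A * t * ((1 - A * t) + (1 - A * L ^ 2 * t)) := by ring
    have : 0 < A * t * ((1 - A * t) + (1 - A * L ^ 2 * t)) :=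
      mul_pos (mul_pos hA ht0) (by linarith)
    linarith
  rw [hprof]
  linarith

/-! ### One-sided bounds near the puncture -/

theorem isCompact_annulus (c : Plane) (ε r : ℝ) :
    IsCompact {x : Plane | ε ≤ ‖x - c‖ ∧ ‖x - c‖ ≤ r} := by
  refine (isCompact_closedBall c r).of_isClosed_subset ?_ ?_
  · have h : Continuous fun x : Plane => ‖x - c‖ := by fun_prop
    exact (isClosed_le continuous_const h).inter (isClosed_le h continuous_const)
  · intro x hx
    rw [mem_closedBall_iff_norm]
    exact hx.2

theorem mem_puncturedDisk {c p : Plane} {R : ℝ} :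
    p ∈ puncturedDisk c R ↔ 0 < ‖p - c‖ ∧ ‖p - c‖ < R := by
  simp [puncturedDisk, dist_eq_norm, sub_eq_zero, and_comm]

/-- A function whose graph has no point with both `κ₁ ≤ A` and `κ₂ ≤ -B` is bounded above near the
puncture, by comparison with tori. -/
theorem bddAbove_of_no_torus_contact {u : Plane → ℝ} {c : Plane} {R A B : ℝ} (hR : 0 < R)
    (hu : ∀ p ∈ puncturedDisk c R, ContDiffAt ℝ 2 u p) (hA : 0 < A) (hB : 0 < B)
    (hno : ∀ p ∈ puncturedDisk c R,
      (∀ v, hessianForm u p v ≤ A * (areaElement u p * metricForm u p v)) →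
      ∀ v, v ≠ 0 → -B * (areaElement u p * metricForm u p v) < hessianForm u p v) :
    ∃ δ, 0 < δ ∧ δ ≤ R ∧ ∃ C, ∀ p ∈ puncturedDisk c δ, u p ≤ C := by
  obtain ⟨r, hr0, hrR, hAr, hBr⟩ :
      ∃ r, 0 < r ∧ r < R ∧ A * r ≤ 1 / 2 ∧ B * r ≤ 1 / 2 := by
    refine ⟨min (R / 2) (min (1 / (2 * A)) (1 / (2 * B))), by positivity,
      (min_le_left _ _).trans_lt (by linarith), ?_, ?_⟩
    · calc A * _ ≤ A * (1 / (2 * A)) :=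
            mul_le_mul_of_nonneg_left ((min_le_right _ _).trans (min_le_left _ _)) hA.le
        _ = 1 / 2 := by field_simp
    · calc B * _ ≤ B * (1 / (2 * B)) :=
            mul_le_mul_of_nonneg_left ((min_le_right _ _).trans (min_le_right _ _)) hB.le
        _ = 1 / 2 := by field_simp
  have hcont : ∀ ε, 0 < ε → ContinuousOn u {x | ε ≤ ‖x - c‖ ∧ ‖x - c‖ ≤ r} := fun ε hε x hx =>
    (hu x (mem_puncturedDisk.2 ⟨hε.trans_le hx.1, hx.2.trans_lt hrR⟩)).continuousAt.continuousWithinAt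
  obtain ⟨M, hM⟩ := (isCompact_annulus c r r).bddAbove_image (hcont r hr0)
  refine ⟨r, hr0, hrR.le, M + 1 / A, fun p hp => ?_⟩
  obtain ⟨hp0, hpr⟩ := mem_puncturedDisk.1 hp
  -- The hole only has to leave `p` outside it; the bound `M + 1 / A` was fixed before `ε`.
  obtain ⟨ε, hε, hεp⟩ := exists_between hp0
  obtain ⟨x, hx, hxmax⟩ := (isCompact_annulus c ε r).exists_isMaxOn ⟨p, hεp.le, hpr.le⟩
    (f := fun x => u x - torusProfile A ε ‖x - c‖)
    ((hcont ε hε).sub ((continuous_torusProfile A ε).comp (by fun_prop)).continuousOn)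
  have hpx : u p - torusProfile A ε ‖p - c‖ ≤ u x - torusProfile A ε ‖x - c‖ :=
    hxmax ⟨hεp.le, hpr.le⟩
  have hxR : x ∈ puncturedDisk c R :=
    mem_puncturedDisk.2 ⟨hε.trans_le hx.1, hx.2.trans_lt hrR⟩
  rcases hx.2.eq_or_lt with hxr | hxr
  · have h1 : u x ≤ M := hM ⟨x, ⟨hxr.ge, hxr.le⟩, rfl⟩
    linarith [torusProfile_nonpos hA ε ‖p - c‖, neg_inv_le_torusProfile hA ε ‖x - c‖]
  rcases hx.1.eq_or_lt with hxε | hxε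
  · obtain ⟨y, hy1, hy2, hy⟩ := exists_gt_of_inner_boundary
      ((hu x hxR).differentiableAt (by norm_num)) hA hε hxε.symm (hεp.trans hpr)
    exact absurd (hxmax ⟨hy1, hy2⟩) (not_le.2 hy)
  · have hnhds : {x | ε ≤ ‖x - c‖ ∧ ‖x - c‖ ≤ r} ∈ 𝓝 x := by
      have h : ContinuousAt (fun y => ‖y - c‖) x := by fun_prop
      filter_upwards [h.eventually (lt_mem_nhds hxε), h.eventually (gt_mem_nhds hxr)]
        with y h1 h2 using ⟨h1.le, h2.le⟩
    obtain ⟨h1, v, hv, h2⟩ := torus_contact (B := B) (hu x hxR) hA hε hxε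
      ((mul_le_mul_of_nonneg_left hx.2 hA.le).trans hAr)
      ((mul_le_mul_of_nonneg_left hx.2 hB.le).trans hBr) (hxmax.isLocalMax hnhds)
    exact absurd h2 (not_le.2 (hno x hxR h1 v hv))

/-- A function with nonnegative Hessian is bounded below near the puncture. -/
theorem bddBelow_of_hessianForm_nonneg {u : Plane → ℝ} {c : Plane} {R : ℝ} (hR : 0 < R)
    (hu : ∀ p ∈ puncturedDisk c R, ContDiffAt ℝ 2 u p)
    (hpos : ∀ p ∈ puncturedDisk c R, ∀ v, 0 ≤ hessianForm u p v) :
    ∃ δ, 0 < δ ∧ δ ≤ R ∧ ∃ C, ∀ p ∈ puncturedDisk c δ, C ≤ u p := by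
  have hsub : ∀ x, R / 4 ≤ ‖x - c‖ ∧ ‖x - c‖ ≤ R / 2 → x ∈ puncturedDisk c R := fun x hx =>
    mem_puncturedDisk.2 ⟨by linarith [hx.1], by linarith [hx.2]⟩
  obtain ⟨M, hM⟩ := (isCompact_annulus c (R / 4) (R / 2)).exists_bound_of_continuousOn
    (f := u) fun x hx => (hu x (hsub x hx)).continuousAt.continuousWithinAt
  refine ⟨R / 4, by positivity, by linarith, -(3 * M), fun p hp => ?_⟩
  obtain ⟨hp0, hpr⟩ := mem_puncturedDisk.1 hp
  set ρ := ‖p - c‖ with hρ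
  set e : Plane := (1 / ρ) • (p - c) with he
  have hnorm : ∀ t : ℝ, 0 < t → ‖c + t • e - c‖ = t := by
    intro t ht
    rw [add_sub_cancel_left, norm_smul, he, norm_smul, ← hρ, Real.norm_of_nonneg ht.le,
      Real.norm_of_nonneg (by positivity)]
    field_simp
  have hmem : ∀ t ∈ Set.Ioo 0 R, c + t • e ∈ puncturedDisk c R := fun t ht =>
    mem_puncturedDisk.2 (by rw [hnorm t ht.1]; exact ht)
  have hconv : ConvexOn ℝ (Set.Ioo 0 R) fun t : ℝ => u (c + t • e) := by
    refine convexOn_of_hasDerivWithinAt2_nonneg (convex_Ioo 0 R)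
      (f' := fun t => fderiv ℝ u (c + t • e) e) (f'' := fun t => hessianForm u (c + t • e) e)
      ?_ ?_ ?_ ?_
    · exact fun t ht => (hasDerivAt_line (hu _ (hmem t ht))).continuousAt.continuousWithinAt
    · rw [interior_Ioo]
      exact fun t ht => (hasDerivAt_line (hu _ (hmem t ht))).hasDerivWithinAt
    · rw [interior_Ioo]
      exact fun t ht => (hasDerivAt_fderiv_line (hu _ (hmem t ht))).hasDerivWithinAt
    · rw [interior_Ioo]
      exact fun t ht => hpos _ (hmem t ht) e
  -- The slope over `[ρ, R / 4]` is at most that over `[R / 4, R / 2]`, hence at most `8 * M / R`.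
  -- The first interval is shorter than `R / 4`, so `u p` lies at most `2 * M` below the value at
  -- radius `R / 4`, which is at least `-M`.
  have hslope := hconv.slope_mono_adjacent (x := ρ) (y := R / 4) (z := R / 2)
    ⟨hp0, by linarith⟩ ⟨by linarith, by linarith⟩ hpr (by linarith)
  have hp' : c + ρ • e = p := by
    rw [he, smul_smul, mul_one_div_cancel hp0.ne', one_smul, add_sub_cancel]
  rw [hp'] at hslope
  have h1 := abs_le.1 (hM (c + (R / 4) • e)
    (by rw [Set.mem_ofPred_eq, hnorm _ (by positivity)]; constructor <;> linarith))
  have h2 := abs_le.1 (hM (c + (R / 2) • e)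
    (by rw [Set.mem_ofPred_eq, hnorm _ (by positivity)]; constructor <;> linarith))
  have h3 : (u (c + (R / 2) • e) - u (c + (R / 4) • e)) / (R / 2 - R / 4) ≤ 2 * M / (R / 4) := by
    rw [show R / 2 - R / 4 = R / 4 by ring]
    gcongr
    linarith
  have h4 := hslope.trans h3
  rw [div_le_div_iff₀ (by linarith) (by positivity)] at h4
  have hM0 : 0 ≤ M := by linarith
  nlinarith [mul_nonneg hM0 hp0.le]

/-! ### Using the Weingarten equation -/

theorem IsEllipticFunction.strictAntiOn {α : ℝ} {g : ℝ → ℝ} (hg : IsEllipticFunction α g) :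
    StrictAntiOn g (Set.Ici α) := by
  refine strictAntiOn_of_deriv_neg (convex_Ici α) hg.contDiffOn.continuousOn fun x hx => ?_
  have := hg.deriv_neg x (interior_subset hx)
  rwa [derivWithin_of_mem_nhds (mem_interior_iff_mem_nhds.1 hx)] at this

/-- Boundedness for the upward orientation, with the principal curvatures given as the extrema of
the quotient of the fundamental forms. -/
theorem bounded_of_extrema {w : Plane → ℝ} {c : Plane} {R α : ℝ} {g : ℝ → ℝ} (hR : 0 < R)
    (hw : ∀ p ∈ puncturedDisk c R, ContDiffAt ℝ 2 w p) (hg : StrictAntiOn g (Set.Ici α))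
    (hκ : ∀ p ∈ puncturedDisk c R, ∃ κ₁ κ₂ : ℝ, α ≤ κ₁ ∧ κ₂ = g κ₁ ∧
      (∀ v, κ₂ * (areaElement w p * metricForm w p v) ≤ hessianForm w p v) ∧
      (∀ v, hessianForm w p v ≤ κ₁ * (areaElement w p * metricForm w p v)) ∧
      (∃ v, v ≠ 0 ∧ hessianForm w p v = κ₂ * (areaElement w p * metricForm w p v)) ∧
      (∃ v, v ≠ 0 ∧ hessianForm w p v = κ₁ * (areaElement w p * metricForm w p v))) :
    ∃ δ, 0 < δ ∧ δ ≤ R ∧ ∃ C, ∀ p ∈ puncturedDisk c δ, |w p| ≤ C := by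
  have hI : ∀ p {v : Plane}, v ≠ 0 → 0 < areaElement w p * metricForm w p v := fun p v hv =>
    mul_pos (areaElement_pos w p) (metricForm_pos w p hv)
  have above : ∃ δ, 0 < δ ∧ δ ≤ R ∧ ∃ C, ∀ p ∈ puncturedDisk c δ, w p ≤ C := by
    -- `A` must be positive and lie in the domain of `g`; `B` is chosen so that `-B < g A`.
    refine bddAbove_of_no_torus_contact (A := max α 0 + 1) (B := |g (max α 0 + 1)| + 1) hR hw
      (by positivity) (by positivity) fun p hp h v hv => ?_
    obtain ⟨κ₁, κ₂, hα, hgκ, hlow, -, -, v₁, hv₁, e₁⟩ := hκ p hp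
    have h1 : κ₁ ≤ max α 0 + 1 := le_of_mul_le_mul_right (e₁ ▸ h v₁) (hI p hv₁)
    have h2 : g (max α 0 + 1) ≤ κ₂ := by
      rw [hgκ]
      exact hg.antitoneOn hα (Set.mem_Ici.2 (hα.trans h1)) h1
    refine lt_of_lt_of_le (mul_lt_mul_of_pos_right ?_ (hI p hv)) (hlow v)
    linarith [neg_abs_le (g (max α 0 + 1))]
  have below : ∃ δ, 0 < δ ∧ δ ≤ R ∧ ∃ C, ∀ p ∈ puncturedDisk c δ, C ≤ w p := by
    by_cases hneg : ∃ x, α ≤ x ∧ g x < 0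
    · obtain ⟨x, hxα, hx⟩ := hneg
      set B := max x 1
      have hBα : α ≤ B := hxα.trans (le_max_left _ _)
      have hgB : g B < 0 := (hg.antitoneOn hxα hBα (le_max_left _ _)).trans_lt hx
      -- Contact for `-w` would mean `κ₂ ≥ g B / 2` and `κ₁ ≥ B`. As `g B < 0`, the first gives `κ₂
      -- > g B`, hence `κ₁ < B`. The maximum with `1` in `B` serves to make it positive.
      have := bddAbove_of_no_torus_contact (u := fun q => -w q) (A := -g B / 2) (B := B) hR
        (fun p hp => (hw p hp).neg) (by linarith) (lt_max_of_lt_right one_pos)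
        fun p hp h v hv => ?_
      · obtain ⟨δ, h0, h1, C, hC⟩ := this
        exact ⟨δ, h0, h1, -C, fun p hp => by linarith [hC p hp]⟩
      · obtain ⟨κ₁, κ₂, hα, hgκ, -, hupp, ⟨v₂, hv₂, e₂⟩, -⟩ := hκ p hp
        simp only [hessianForm_neg, areaElement_neg, metricForm_neg] at h ⊢
        have h1 : g B / 2 ≤ κ₂ := by
          refine le_of_mul_le_mul_right ?_ (hI p hv₂)
          linarith [h v₂]
        have h2 : κ₁ < B := by
          by_contra! hle
          linarith [hg.antitoneOn hBα hα hle]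
        linarith [hupp v, mul_lt_mul_of_pos_right h2 (hI p hv)]
    · push Not at hneg
      refine bddBelow_of_hessianForm_nonneg hR hw fun p hp v => ?_
      obtain ⟨κ₁, κ₂, hα, hgκ, hlow, -⟩ := hκ p hp
      refine le_trans (mul_nonneg (hgκ ▸ hneg κ₁ hα) ?_) (hlow v)
      exact mul_nonneg (areaElement_pos w p).le (by unfold metricForm; positivity)
  obtain ⟨δ₁, h1, h1R, C₁, hC₁⟩ := above
  obtain ⟨δ₂, h2, -, C₂, hC₂⟩ := below
  refine ⟨min δ₁ δ₂, lt_min h1 h2, (min_le_left _ _).trans h1R, max |C₁| |C₂|, fun p hp => ?_⟩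
  obtain ⟨hp0, hp1⟩ := mem_puncturedDisk.1 hp
  obtain ⟨ha, hb⟩ := lt_min_iff.1 hp1
  have ha := hC₁ p (mem_puncturedDisk.2 ⟨hp0, ha⟩)
  have hb := hC₂ p (mem_puncturedDisk.2 ⟨hp0, hb⟩)
  rw [abs_le]
  constructor
  · linarith [neg_abs_le C₂, le_max_right |C₁| |C₂|]
  · linarith [le_abs_self C₁, le_max_left |C₁| |C₂|]

end EllipticWeingarten

theorem mainTheorem8 (c : EllipticWeingarten.Plane) (R : ℝ) (hR : 0 < R)
    (u : EllipticWeingarten.Plane → ℝ)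
    (hu : EllipticWeingarten.IsEllipticWeingartenGraph
      (EllipticWeingarten.puncturedDisk c R) u) :
    ∃ δ : ℝ, 0 < δ ∧ δ ≤ R ∧
      ∃ C : ℝ, ∀ p ∈ EllipticWeingarten.puncturedDisk c δ, |u p| ≤ C := by
  obtain ⟨hC2, α, g, hg, ε, hε, hκ⟩ := hu
  have hat : ∀ p ∈ EllipticWeingarten.puncturedDisk c R, ContDiffAt ℝ 2 u p := fun p hp =>
    hC2.contDiffAt ((EllipticWeingarten.isOpen_puncturedDisk c R).mem_nhds hp)
  rcases hε with rfl | rfl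
  · refine EllipticWeingarten.bounded_of_extrema hR hat hg.strictAntiOn fun p hp => ?_
    obtain ⟨κ₁, κ₂, hpc, hα, hgκ⟩ := hκ p hp
    exact ⟨κ₁, κ₂, hα, hgκ, by simpa using hpc.extrema (hat p hp)⟩
  · have := EllipticWeingarten.bounded_of_extrema (w := fun q => -u q) hR
      (fun p hp => (hat p hp).neg) hg.strictAntiOn fun p hp => ?_
    · simpa only [abs_neg] using this
    · obtain ⟨κ₁, κ₂, hpc, hα, hgκ⟩ := hκ p hp
      refine ⟨κ₁, κ₂, hα, hgκ, ?_⟩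
      simpa only [EllipticWeingarten.hessianForm_neg, EllipticWeingarten.areaElement_neg,
        EllipticWeingarten.metricForm_neg, neg_one_mul] using hpc.extrema (hat p hp)
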